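/- Let $\lambda_k=k^2\pi^2$ and $e_k(\xi)=\sqrt2\sin(k\pi\xi)$ for $k\ge 1$, which are the eigenvalues and the orthonormal eigenfunctions in $L^2(0,1)$ of the operator $-\partial_\xi^2$ with homogeneous Dirichlet boundary conditions, let $\|\cdot\|$ be the norm of $L^2(0,1)$, and let $S(t)x=\sum_{k\ge1}e^{-\lambda_k t}\langle x,e_k\rangle e_k$, $t\ge0$, be the associated heat semigroup. Let $p\in\{1,2,\dots\}$, $H\in(1/4,1/2)\cup(1/2,1)$ and $\alpha\in(0,2H-1/2)$. Then there exists a constant $C_{p,H,\alpha}\in(0,\infty)$, depending only on $p$, $H$ and $\alpha$, such that the following holds. Let $(\beta_k^H)_{k\ge1}$ be any sequence of independent real-valued fractional Brownian motions with Hurst index $H$ (centered Gaussian processes with covariance $\frac12(t^{2H}+s^{2H}-|t-s|^{2H})$ and almost surely continuous paths) on a probability space, and let $B^H=\sum_{k\ge1}\beta_k^He_k$ be the associated cylindrical fractional Brownian motion. For every $t\ge0$ the stochastic convolution \[ Z^H(t)=\int_0^tS(t-s)\,\mathrm dB^H(s)=\sum_{k,\ell\ge1}\Bigl(\int_0^t\langle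 S(t-s)e_\ell,e_k\rangle\,\mathrm d\beta_\ell^H(s)\Bigr)e_k \] is well defined, the series converging unconditionally in $L^2(\Omega;L^2(0,1))$, where for $\phi$ of class $C^1$ on $[0,t]$ one sets $\int_0^t\phi(s)\,\mathrm d\beta(s)=\phi(t)\beta(t)-\int_0^t\phi'(s)\beta(s)\,\mathrm ds$. Moreover, for all $t_2\ge t_1\ge0$, the random variable $\|Z^H(t_2)-Z^H(t_1)\|$ has a finite moment of order $2p$, and \[ \mathbb E\bigl[\|Z^H(t_2)-Z^H(t_1)\|^{2p}\bigr]\le C_{p,H,\alpha}\,|t_2-t_1|^{p\alpha}. \] -/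

import Mathlib

open MeasureTheory ProbabilityTheory Filter Topology
open scoped NNReal ENNReal

noncomputable section

/-- The Hilbert space `L²((0,1); ℝ)`. -/
abbrev L2Unit : Type :=
  Lp ℝ 2 ((volume : Measure ℝ).restrict (Set.Ioo (0 : ℝ) 1))

/-- The eigenvalues `(kπ)²`, `k ≥ 1`, of the Dirichlet Laplacian on `(0,1)`;
the index `k : ℕ` stands for the mode number `k + 1`. -/
def dirichletEigenvalue (k : ℕ) : ℝ := ((k : ℝ) + 1) ^ 2 * Real.pi ^ 2

/-- The function `ξ ↦ √2 sin((k+1)πξ)`. -/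
def sineFun (k : ℕ) (ξ : ℝ) : ℝ := √2 * Real.sin (((k : ℝ) + 1) * Real.pi * ξ)

theorem memLp_sineFun (k : ℕ) :
    MemLp (sineFun k) 2 ((volume : Measure ℝ).restrict (Set.Ioo (0 : ℝ) 1)) := by
  have hc : Continuous (sineFun k) := by
    unfold sineFun
    fun_prop
  refine MemLp.of_bound hc.aestronglyMeasurable (√2) (Eventually.of_forall fun ξ => ?_)
  unfold sineFun
  rw [norm_mul, Real.norm_of_nonneg (Real.sqrt_nonneg 2)]
  exact mul_le_of_le_one_right (Real.sqrt_nonneg 2) (Real.abs_sin_le_one _)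

/-- The orthonormal system of eigenfunctions, as elements of `L²((0,1); ℝ)`. -/
def sineBasis (k : ℕ) : L2Unit := (memLp_sineFun k).toLp (sineFun k)

/-- The heat semigroup `S(t)x = ∑ₖ exp(-λₖ t) ⟨x, eₖ⟩ eₖ` (used for `t ≥ 0`). -/
def heatSemigroup (t : ℝ) (x : L2Unit) : L2Unit :=
  ∑' k : ℕ, (Real.exp (-dirichletEigenvalue k * t) * inner ℝ x (sineBasis k)) • sineBasis k

/-- A real-valued fractional Brownian motion with Hurst index `H`: a centered Gaussian process
with the fractional covariance and almost surely continuous paths. -/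
structure IsFractionalBrownianMotion {Ω : Type*} [MeasurableSpace Ω]
    (H : ℝ) (β : ℝ≥0 → Ω → ℝ) (μ : Measure Ω) : Prop where
  gaussian : IsGaussianProcess β μ
  mean : ∀ t, ∫ ω, β t ω ∂μ = 0
  covariance : ∀ t s : ℝ≥0, ∫ ω, β t ω * β s ω ∂μ =
    ((t : ℝ) ^ (2 * H) + (s : ℝ) ^ (2 * H) - |(t : ℝ) - (s : ℝ)| ^ (2 * H)) / 2
  cont : ∀ᵐ ω ∂μ, Continuous fun t => β t ω

/-- A sequence of independent fractional Brownian motions with Hurst index `H`; it represents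
the cylindrical fractional Brownian motion `B^H(t) = ∑ₖ βₖ(t) eₖ`. -/
structure IsCylindricalFBM {Ω : Type*} [MeasurableSpace Ω]
    (H : ℝ) (β : ℕ → ℝ≥0 → Ω → ℝ) (μ : Measure Ω) : Prop where
  fbm : ∀ k, IsFractionalBrownianMotion H (β k) μ
  indep : iIndepFun (fun k ω t => β k t ω) μ

/-- The stochastic integral `∫₀ᵀ φ(s) dβ(s)` of a deterministic integrand `φ` of class `C¹`
on `[0,T]`, defined by `φ(T)β(T) - ∫₀ᵀ φ'(s)β(s) ds`. -/
def stochIntegralC1 {Ω : Type*} (β : ℝ≥0 → Ω → ℝ) (T : ℝ≥0) (φ : ℝ → ℝ) (ω : Ω) : ℝ :=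
  φ T * β T ω -
    ∫ s in (0 : ℝ)..T, derivWithin φ (Set.Icc 0 (T : ℝ)) s * β s.toNNReal ω

/-- `X` is (a version of) the `L²((0,1))`-valued stochastic integral
`∫₀ᵀ Θ(s) dB^H(s) = ∑_{k,ℓ} (∫₀ᵀ ⟨Θ(s) e_ℓ, e_k⟩ dβ_ℓ(s)) e_k`, for an operator-valued
integrand whose matrix coefficients are of class `C¹` on `[0,T]`; the double series converges
to `X` in mean square (unconditionally). -/
structure IsCylindricalIntegral {Ω : Type*} [MeasurableSpace Ω]
    (μ : Measure Ω) (β : ℕ → ℝ≥0 → Ω → ℝ) (T : ℝ≥0) (Θ : ℝ → L2Unit → L2Unit)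
    (X : Ω → L2Unit) : Prop where
  contDiffOn : ∀ k l : ℕ, ContDiffOn ℝ 1
    (fun s => inner ℝ (Θ s (sineBasis l)) (sineBasis k)) (Set.Icc 0 (T : ℝ))
  aestronglyMeasurable : AEStronglyMeasurable X μ
  tendsto : Tendsto (fun F : Finset (ℕ × ℕ) => eLpNorm (fun ω => X ω -
      ∑ q ∈ F, stochIntegralC1 (β q.2) T
        (fun s => inner ℝ (Θ s (sineBasis q.2)) (sineBasis q.1)) ω • sineBasis q.1) 2 μ)
    atTop (𝓝 0)

/-- `Z` is a fractional Ornstein–Uhlenbeck process driven by `B^H = ∑ₖ βₖ eₖ`: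
`Z(t) = ∫₀ᵗ S(t-s) dB^H(s)` for every `t ≥ 0`. -/
def IsFractionalOU {Ω : Type*} [MeasurableSpace Ω]
    (μ : Measure Ω) (β : ℕ → ℝ≥0 → Ω → ℝ) (Z : ℝ≥0 → Ω → L2Unit) : Prop :=
  ∀ t : ℝ≥0, IsCylindricalIntegral μ β t (fun s => heatSemigroup ((t : ℝ) - s)) (Z t)

end

/-! The semigroup is diagonal in the sine basis, so the double series collapses to `∑ Y_k e_k`,
where `Y_k` is the scalar Ornstein–Uhlenbeck path (`ouPath`) of rate `λ_k` driven by `β_k`.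
Integration by parts makes `Y_k` a pathwise integral of `β_k`, so both ranges of `H` are treated
alike, using only that the `L^q` norm of an increment of `β_k` is a constant times `|t - s|^H`.

For one mode, `‖Y_k(t)‖_q` is at most a constant times `λ_k^(-H)` (`eLpNorm_ouPath_le`) and `‖Y_k(t)
- Y_k(s)‖_q` at most a constant times `(t-s)^H` (`eLpNorm_ouPath_sub_le`). Interpolation gives
`λ_k^(-(H-γ)) (t-s)^γ` for `0 ≤ γ ≤ H`. Parseval and Minkowski in `L^p` for the squares
(`eLpNorm_sum_smul_le`) sum the modes, at the cost of `∑ λ_k^(-2(H-γ)) < ∞`, that is `H - γ > 1/4`;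
the choice `γ = α/2` gives the theorem. Convergence of the series itself is the case `γ = 0`, and
Fatou carries the moment bounds to the limit. -/

/-! ### Riemann sums and time integrals of random paths -/

theorem tendsto_riemannSum_of_continuous {f : ℝ → ℝ} (hf : Continuous f) {a b : ℝ} (hab : a ≤ b) :
    Tendsto (fun n : ℕ => ∑ i ∈ Finset.range (n + 1),
        (b - a) / (n + 1) * f (a + i * ((b - a) / (n + 1))))
      atTop (𝓝 (∫ x in a..b, f x)) := by
  rcases hab.eq_or_lt with rfl | hlt
  · simp
  have huc := isCompact_Icc.uniformContinuousOn_of_continuous (hf.continuousOn (s := Set.Icc a b))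
  rw [Metric.uniformContinuousOn_iff] at huc
  rw [Metric.tendsto_atTop]
  intro ε hε
  obtain ⟨δ, hδ, h⟩ := huc (ε / (2 * (b - a))) (by have := sub_pos.2 hlt; positivity)
  obtain ⟨N, hN⟩ := exists_nat_gt ((b - a) / δ)
  refine ⟨N, fun n hn => ?_⟩
  set s : ℝ := (b - a) / (n + 1) with hs
  have hba : 0 < b - a := sub_pos.2 hlt
  have hn1 : (0 : ℝ) < n + 1 := by positivity
  have hs0 : 0 < s := by positivity
  have hsb : s * (n + 1) = b - a := by rw [hs]; field_simp
  have hsδ : s < δ := by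
    rw [hs, div_lt_iff₀ hn1]
    rw [div_lt_iff₀ hδ] at hN
    have : (N : ℝ) ≤ n := by exact_mod_cast hn
    nlinarith
  have hadj : ∑ i ∈ Finset.range (n + 1), ∫ x in (a + (i : ℕ) * s)..(a + ((i + 1 : ℕ) : ℝ) * s), f x
      = ∫ x in a..b, f x := by
    rw [intervalIntegral.sum_integral_adjacent_intervals (a := fun i : ℕ => a + i * s)
      fun k _ => hf.intervalIntegrable _ _]
    congr 1
    · simp
    · push_cast; linarith
  rw [Real.dist_eq, ← hadj, ← Finset.sum_sub_distrib]
  have hterm : ∀ i ∈ Finset.range (n + 1),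
      |s * f (a + i * s) - ∫ x in (a + (i : ℕ) * s)..(a + ((i + 1 : ℕ) : ℝ) * s), f x|
        ≤ ε / (2 * (b - a)) * s := by
    intro i hi
    have hi' : (i : ℝ) + 1 ≤ n + 1 := by exact_mod_cast Finset.mem_range.1 hi
    have hi0 : (0 : ℝ) ≤ i := by positivity
    have e1 : s * f (a + i * s) = ∫ x in (a + (i : ℕ) * s)..(a + ((i + 1 : ℕ) : ℝ) * s),
        f (a + i * s) := by
      rw [intervalIntegral.integral_const, smul_eq_mul]; push_cast; ring
    rw [e1, ← intervalIntegral.integral_sub (by simp) (hf.intervalIntegrable _ _)]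
    rw [← Real.norm_eq_abs]
    refine (intervalIntegral.norm_integral_le_of_norm_le_const (E := ℝ)
      (C := ε / (2 * (b - a))) ?_).trans (le_of_eq ?_)
    · intro x hx
      rw [Set.uIoc_of_le (by push_cast; nlinarith)] at hx
      push_cast at hx
      have h1 : a + i * s ∈ Set.Icc a b := ⟨by nlinarith, by nlinarith⟩
      have h2 : x ∈ Set.Icc a b := ⟨by nlinarith [hx.1], by nlinarith [hx.2]⟩
      refine (h _ h1 _ h2 ?_).le
      rw [Real.dist_eq, abs_sub_lt_iff]
      constructor <;> linarith [hx.1, hx.2]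
    · push_cast
      rw [abs_of_nonneg (by linarith)]; ring
  refine ((Finset.abs_sum_le_sum_abs _ _).trans (Finset.sum_le_sum hterm)).trans_lt ?_
  rw [Finset.sum_const, Finset.card_range, nsmul_eq_mul]
  push_cast
  have : ((n : ℝ) + 1) * (ε / (2 * (b - a)) * s) = ε / 2 := by
    rw [show ((n : ℝ) + 1) * (ε / (2 * (b - a)) * s) = ε / (2 * (b - a)) * (s * (n + 1)) by ring,
      hsb]
    field_simp
  linarith

section RandomIntegral

variable {Ω : Type*} [MeasurableSpace Ω] {μ : Measure Ω} {X : ℝ → Ω → ℝ} {a b : ℝ}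

theorem aestronglyMeasurable_riemannSum (hm : ∀ r, AEStronglyMeasurable (X r) μ) (n : ℕ) :
    AEStronglyMeasurable (fun ω => ∑ i ∈ Finset.range (n + 1),
      (b - a) / (n + 1) * X (a + i * ((b - a) / (n + 1))) ω) μ :=
  Finset.aestronglyMeasurable_fun_sum _ fun _ _ => (hm _).const_mul _

/-- The integral is an almost sure limit of Riemann sums, each measurable as a finite sum. -/
theorem aestronglyMeasurable_intervalIntegral_of_continuous_paths (hab : a ≤ b)
    (hm : ∀ r, AEStronglyMeasurable (X r) μ) (hc : ∀ᵐ ω ∂μ, Continuous fun r => X r ω) :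
    AEStronglyMeasurable (fun ω => ∫ r in a..b, X r ω) μ :=
  aestronglyMeasurable_of_tendsto_ae atTop (aestronglyMeasurable_riemannSum hm)
    (hc.mono fun _ h => tendsto_riemannSum_of_continuous h hab)

/-- Minkowski's integral inequality for a process with continuous paths, without any joint
measurability. -/
theorem eLpNorm_intervalIntegral_le (hab : a ≤ b) {q : ℝ≥0∞} (hq : 1 ≤ q)
    (hm : ∀ r, AEStronglyMeasurable (X r) μ) (hc : ∀ᵐ ω ∂μ, Continuous fun r => X r ω)
    {g : ℝ → ℝ} (hg : Continuous g) (hg0 : ∀ r ∈ Set.Icc a b, 0 ≤ g r)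
    (hXg : ∀ r ∈ Set.Icc a b, eLpNorm (X r) q μ ≤ ENNReal.ofReal (g r)) :
    eLpNorm (fun ω => ∫ r in a..b, X r ω) q μ ≤ ENNReal.ofReal (∫ r in a..b, g r) := by
  have hba : 0 ≤ b - a := sub_nonneg.2 hab
  -- Fatou reduces the claim to Riemann sums, where the ordinary triangle inequality applies; the
  -- matching sums of `g` converge to its integral.
  refine (Lp.eLpNorm_lim_le_liminf_eLpNorm (aestronglyMeasurable_riemannSum (a := a) (b := b) hm) _
    (hc.mono fun _ h => tendsto_riemannSum_of_continuous h hab)).trans ?_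
  have hlim := ENNReal.tendsto_ofReal (tendsto_riemannSum_of_continuous hg hab)
  rw [← hlim.liminf_eq]
  refine liminf_le_liminf (Eventually.of_forall fun n => ?_)
  have hmem : ∀ i ∈ Finset.range (n + 1), a + i * ((b - a) / (n + 1)) ∈ Set.Icc a b := by
    intro i hi
    have hi' : (i : ℝ) ≤ n + 1 := by exact_mod_cast (Finset.mem_range.1 hi).le
    have h1 : (0 : ℝ) < n + 1 := by positivity
    refine ⟨le_add_of_nonneg_right (by positivity), ?_⟩
    have : (i : ℝ) * ((b - a) / (n + 1)) ≤ (n + 1) * ((b - a) / (n + 1)) := by gcongr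
    rw [mul_div_cancel₀ _ h1.ne'] at this
    linarith
  rw [ENNReal.ofReal_sum_of_nonneg fun i hi => mul_nonneg (by positivity) (hg0 _ (hmem i hi))]
  have := eLpNorm_sum_le (μ := μ) (p := q) (s := Finset.range (n + 1))
    (f := fun (i : ℕ) ω => (b - a) / (n + 1) * X (a + i * ((b - a) / (n + 1))) ω)
    (fun i _ => (hm _).const_mul _) hq
  have e : (∑ i ∈ Finset.range (n + 1),
      (fun (i : ℕ) ω => (b - a) / (n + 1) * X (a + i * ((b - a) / (n + 1))) ω) i) =
      fun ω => ∑ i ∈ Finset.range (n + 1), (b - a) / (n + 1) * X (a + i * ((b - a) / (n + 1))) ω := by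
    ext ω; simp
  rw [e] at this
  refine this.trans (Finset.sum_le_sum fun i hi => ?_)
  have hsmul := eLpNorm_const_smul ((b - a) / (n + 1)) (X (a + i * ((b - a) / (n + 1)))) q μ
  rw [ENNReal.ofReal_mul (by positivity)]
  refine hsmul.le.trans ?_
  rw [Real.enorm_of_nonneg (by positivity)]
  gcongr
  exact hXg _ (hmem i hi)

end RandomIntegral

/-! ### Scalar Ornstein–Uhlenbeck paths: pathwise identities -/

/-- The path of the scalar Ornstein–Uhlenbeck process with rate `l` driven by the path `b`. -/
noncomputable def ouPath (l : ℝ) (b : ℝ → ℝ) (t : ℝ) : ℝ :=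
  b t - ∫ r in (0 : ℝ)..t, l * Real.exp (-l * (t - r)) * b r

theorem integral_mul_exp_neg_mul_sub (l s t : ℝ) :
    ∫ r in s..t, l * Real.exp (-l * (t - r)) = 1 - Real.exp (-l * (t - s)) := by
  have := intervalIntegral.integral_eq_sub_of_hasDerivAt (a := s) (b := t)
    (f := fun r => Real.exp (-l * (t - r))) (f' := fun r => l * Real.exp (-l * (t - r)))
    (fun x _ => by
      have := (((hasDerivAt_id x).const_sub t).const_mul (-l)).exp
      simpa [mul_comm] using this)
    (Continuous.intervalIntegrable (by fun_prop) _ _)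
  simpa using this

/-- The kernel has mass `1 - exp(-l t)`, so `b r` can be traded for the increment `b t - b r`, which
is small where the kernel concentrates. -/
theorem ouPath_eq (l : ℝ) {b : ℝ → ℝ} (hb : Continuous b) (t : ℝ) :
    ouPath l b t = Real.exp (-l * t) * b t +
      ∫ r in (0 : ℝ)..t, l * Real.exp (-l * (t - r)) * (b t - b r) := by
  have h := integral_mul_exp_neg_mul_sub l 0 t
  simp_rw [mul_sub (l * Real.exp _)]
  rw [intervalIntegral.integral_sub (Continuous.intervalIntegrable (by fun_prop) _ _)
    (Continuous.intervalIntegrable (by fun_prop) _ _), intervalIntegral.integral_mul_const, h,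
    ouPath, sub_zero]
  ring

/-- Restart at time `s`: the past enters only through `ouPath l b s`, damped by `exp(-l (t - s))`.
-/
theorem ouPath_sub_ouPath (l : ℝ) {b : ℝ → ℝ} (hb : Continuous b) (s t : ℝ) :
    ouPath l b t - ouPath l b s = b t - b s -
      (∫ r in s..t, l * Real.exp (-l * (t - r)) * (b r - b s)) -
        (1 - Real.exp (-l * (t - s))) * ouPath l b s := by
  have h := integral_mul_exp_neg_mul_sub l s t
  simp_rw [mul_sub (l * Real.exp _)]
  rw [intervalIntegral.integral_sub (Continuous.intervalIntegrable (by fun_prop) _ _)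
    (Continuous.intervalIntegrable (by fun_prop) _ _), intervalIntegral.integral_mul_const, h,
    ouPath, ouPath, ← intervalIntegral.integral_add_adjacent_intervals (a := 0) (b := s) (c := t)
    (Continuous.intervalIntegrable (by fun_prop) _ _)
    (Continuous.intervalIntegrable (by fun_prop) _ _)]
  have e : ∫ r in (0 : ℝ)..s, l * Real.exp (-l * (t - r)) * b r =
      Real.exp (-l * (t - s)) * ∫ r in (0 : ℝ)..s, l * Real.exp (-l * (s - r)) * b r := by
    rw [← intervalIntegral.integral_const_mul]
    refine intervalIntegral.integral_congr fun r _ => ?_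
    rw [show -l * (t - r) = -l * (t - s) + -l * (s - r) by ring, Real.exp_add]
    ring
  rw [e]
  ring

/-- The antiderivative `exp(-l(t-r)) (2 + l(t-r))` equals 2 at `r = t` and is nonnegative at `r =
0`. -/
theorem integral_mul_exp_mul_one_add (l t : ℝ) (hl : 0 ≤ l) (ht : 0 ≤ t) :
    ∫ r in (0 : ℝ)..t, l * Real.exp (-l * (t - r)) * (1 + l * (t - r)) ≤ 2 := by
  have := intervalIntegral.integral_eq_sub_of_hasDerivAt (a := 0) (b := t)
    (f := fun r => Real.exp (-l * (t - r)) * (2 + l * (t - r)))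
    (f' := fun r => l * Real.exp (-l * (t - r)) * (1 + l * (t - r)))
    (fun x _ => by
      have h1 := (((hasDerivAt_id x).const_sub t).const_mul (-l)).exp
      have h2 := (((hasDerivAt_id x).const_sub t).const_mul l).const_add 2
      refine (h1.mul h2).congr_deriv ?_
      simp only [id]
      ring)
    (Continuous.intervalIntegrable (by fun_prop) _ _)
  rw [this]
  have : 0 ≤ Real.exp (-l * (t - 0)) * (2 + l * (t - 0)) := by
    have : 0 ≤ l * (t - 0) := by simpa using mul_nonneg hl ht
    positivity
  simp only [sub_self, mul_zero, Real.exp_zero] at *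
  linarith

theorem rpow_le_one_add {x H : ℝ} (hx : 0 ≤ x) (hH0 : 0 ≤ H) (hH1 : H ≤ 1) : x ^ H ≤ 1 + x := by
  rcases le_total x 1 with h | h
  · have := Real.rpow_le_one hx h hH0
    linarith
  · have := Real.rpow_le_rpow_of_exponent_le h hH1
    rw [Real.rpow_one] at this
    linarith

/-- Scaling of `x^H ≤ 1 + x` at `x = l u`. It extracts the factor `l^(-H)` and leaves an elementary
integral in place of a Gamma function. -/
theorem rpow_le_rpow_neg_mul_one_add {l u H : ℝ} (hl : 0 < l) (hu : 0 ≤ u) (hH0 : 0 ≤ H)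
    (hH1 : H ≤ 1) : u ^ H ≤ l ^ (-H) * (1 + l * u) := by
  have h := rpow_le_one_add (mul_nonneg hl.le hu) hH0 hH1
  rw [Real.mul_rpow hl.le hu] at h
  have h2 : l ^ (-H) * l ^ H = 1 := by rw [← Real.rpow_add hl]; simp
  calc u ^ H = l ^ (-H) * (l ^ H * u ^ H) := by rw [← mul_assoc, h2, one_mul]
    _ ≤ _ := by gcongr

/-! ### Moment bounds for one mode -/

section OUBounds

variable {Ω : Type*} [MeasurableSpace Ω] {μ : Measure Ω} {B : ℝ → Ω → ℝ} {q : ℝ≥0∞} {c H : ℝ}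

theorem aestronglyMeasurable_ouPath (hm : ∀ r, AEStronglyMeasurable (B r) μ)
    (hc : ∀ᵐ ω ∂μ, Continuous fun r => B r ω) (l : ℝ) {t : ℝ} (ht : 0 ≤ t) :
    AEStronglyMeasurable (fun ω => ouPath l (fun r => B r ω) t) μ :=
  (hm t).sub (aestronglyMeasurable_intervalIntegral_of_continuous_paths ht
    (fun r => (hm r).const_mul _) (hc.mono fun _ h => by fun_prop))

/-- In the decomposition `ouPath_eq` the boundary term costs `c l^(-H)` and the integral twice that,
whence the 3. The bound is uniform in `t`. -/
theorem eLpNorm_ouPath_le (hq : 1 ≤ q) (hc0 : 0 ≤ c) (hH0 : 0 ≤ H) (hH1 : H ≤ 1)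
    (hm : ∀ r, AEStronglyMeasurable (B r) μ) (hc : ∀ᵐ ω ∂μ, Continuous fun r => B r ω)
    (hB0 : ∀ t, 0 ≤ t → eLpNorm (B t) q μ ≤ ENNReal.ofReal (c * t ^ H))
    (hB : ∀ s t, 0 ≤ s → s ≤ t →
      eLpNorm (fun ω => B t ω - B s ω) q μ ≤ ENNReal.ofReal (c * (t - s) ^ H))
    {l t : ℝ} (hl : 0 < l) (ht : 0 ≤ t) :
    eLpNorm (fun ω => ouPath l (fun r => B r ω) t) q μ ≤ ENNReal.ofReal (3 * c * l ^ (-H)) := by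
  have hX : ∀ r, AEStronglyMeasurable
      (fun ω => l * Real.exp (-l * (t - r)) * (B t ω - B r ω)) μ :=
    fun r => ((hm t).sub (hm r)).const_mul _
  have hXc : ∀ᵐ ω ∂μ, Continuous fun r => l * Real.exp (-l * (t - r)) * (B t ω - B r ω) :=
    hc.mono fun _ h => by fun_prop
  rw [eLpNorm_congr_ae (hc.mono fun ω h => ouPath_eq l h t)]
  refine (eLpNorm_add_le (f := fun ω => Real.exp (-l * t) * B t ω) ((hm t).const_mul _)
    (aestronglyMeasurable_intervalIntegral_of_continuous_paths ht hX hXc) hq).trans ?_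
  have hlH : 0 ≤ l ^ (-H) := by positivity
  have h1 : eLpNorm (fun ω => Real.exp (-l * t) * B t ω) q μ ≤ ENNReal.ofReal (c * l ^ (-H)) := by
    refine (eLpNorm_const_smul (Real.exp (-l * t)) (B t) q μ).le.trans ?_
    rw [Real.enorm_of_nonneg (by positivity)]
    grw [hB0 t ht]
    rw [← ENNReal.ofReal_mul (by positivity)]
    refine ENNReal.ofReal_le_ofReal ?_
    have h2 := rpow_le_rpow_neg_mul_one_add hl ht hH0 hH1
    -- The growth of `t^H` is absorbed by the damping `exp(-l t)`.
    have h3 : 1 + l * t ≤ Real.exp (l * t) := by linarith [Real.add_one_le_exp (l * t)]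
    calc Real.exp (-l * t) * (c * t ^ H)
        ≤ Real.exp (-l * t) * (c * (l ^ (-H) * Real.exp (l * t))) := by
          grw [h2, h3]
      _ = c * l ^ (-H) * (Real.exp (-l * t) * Real.exp (l * t)) := by ring
      _ = c * l ^ (-H) := by rw [← Real.exp_add]; simp
  have h2 : eLpNorm (fun ω => ∫ r in (0 : ℝ)..t, l * Real.exp (-l * (t - r)) * (B t ω - B r ω)) q μ
      ≤ ENNReal.ofReal (2 * c * l ^ (-H)) := by
    refine (eLpNorm_intervalIntegral_le ht hq hX hXc
      (g := fun r => c * l ^ (-H) * (l * Real.exp (-l * (t - r)) * (1 + l * (t - r))))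
      (by fun_prop) ?_ ?_).trans ?_
    · intro r hr
      have : 0 ≤ l * (t - r) := mul_nonneg hl.le (sub_nonneg.2 hr.2)
      positivity
    · intro r hr
      refine (eLpNorm_const_smul (l * Real.exp (-l * (t - r))) (fun ω => B t ω - B r ω) q μ).le.trans
        ?_
      rw [Real.enorm_of_nonneg (by positivity)]
      grw [hB r t hr.1 hr.2]
      rw [← ENNReal.ofReal_mul (by positivity)]
      refine ENNReal.ofReal_le_ofReal ?_
      have h2 := rpow_le_rpow_neg_mul_one_add hl (sub_nonneg.2 hr.2) hH0 hH1
      grw [h2]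
      exact le_of_eq (by ring)
    · refine ENNReal.ofReal_le_ofReal ?_
      rw [intervalIntegral.integral_const_mul]
      have := integral_mul_exp_mul_one_add l t hl.le ht
      grw [this]
      exact le_of_eq (by ring)
  grw [h1, h2]
  rw [← ENNReal.ofReal_add (by positivity) (by positivity)]
  exact ENNReal.ofReal_le_ofReal (le_of_eq (by ring))

theorem one_sub_exp_neg_le_rpow {x : ℝ} (hx : 0 ≤ x) (hH0 : 0 ≤ H) (hH1 : H ≤ 1) :
    1 - Real.exp (-x) ≤ x ^ H := by
  rcases le_total x 1 with h | h
  · have := Real.rpow_le_rpow_of_exponent_ge_of_imp hx h hH1 (by rintro rfl h; norm_num at *)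
    rw [Real.rpow_one] at this
    linarith [Real.one_sub_le_exp_neg x]
  · have := Real.one_le_rpow h hH0
    linarith [Real.exp_pos (-x)]

/-- The three terms of `ouPath_sub_ouPath` contribute 1, 1 and 3. In the last, `1 - exp(-x) ≤ x^H`
at `x = l(t-s)` cancels the `l^(-H)` of the uniform bound, so the result is free of `l`. -/
theorem eLpNorm_ouPath_sub_le (hq : 1 ≤ q) (hc0 : 0 ≤ c) (hH0 : 0 ≤ H) (hH1 : H ≤ 1)
    (hm : ∀ r, AEStronglyMeasurable (B r) μ) (hc : ∀ᵐ ω ∂μ, Continuous fun r => B r ω)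
    (hB0 : ∀ t, 0 ≤ t → eLpNorm (B t) q μ ≤ ENNReal.ofReal (c * t ^ H))
    (hB : ∀ s t, 0 ≤ s → s ≤ t →
      eLpNorm (fun ω => B t ω - B s ω) q μ ≤ ENNReal.ofReal (c * (t - s) ^ H))
    {l s t : ℝ} (hl : 0 < l) (hs : 0 ≤ s) (hst : s ≤ t) :
    eLpNorm (fun ω => ouPath l (fun r => B r ω) t - ouPath l (fun r => B r ω) s) q μ ≤
      ENNReal.ofReal (5 * c * (t - s) ^ H) := by
  have hts : 0 ≤ t - s := sub_nonneg.2 hst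
  have hX : ∀ r, AEStronglyMeasurable
      (fun ω => l * Real.exp (-l * (t - r)) * (B r ω - B s ω)) μ :=
    fun r => ((hm r).sub (hm s)).const_mul _
  have hXc : ∀ᵐ ω ∂μ, Continuous fun r => l * Real.exp (-l * (t - r)) * (B r ω - B s ω) :=
    hc.mono fun _ h => by fun_prop
  have hI := aestronglyMeasurable_intervalIntegral_of_continuous_paths hst hX hXc
  rw [eLpNorm_congr_ae (hc.mono fun ω h => ouPath_sub_ouPath l h s t)]
  refine (eLpNorm_sub_le (f := fun ω => B t ω - B s ω -
    ∫ r in s..t, l * Real.exp (-l * (t - r)) * (B r ω - B s ω)) (((hm t).sub (hm s)).sub hI)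
    ((aestronglyMeasurable_ouPath hm hc l hs).const_mul _) hq).trans ?_
  have h0 : eLpNorm (fun ω => B t ω - B s ω -
      ∫ r in s..t, l * Real.exp (-l * (t - r)) * (B r ω - B s ω)) q μ ≤ _ :=
    eLpNorm_sub_le (f := fun ω => B t ω - B s ω) ((hm t).sub (hm s)) hI hq
  grw [h0, hB s t hs hst]
  have hE : 0 ≤ 1 - Real.exp (-l * (t - s)) := by
    have : Real.exp (-l * (t - s)) ≤ 1 := Real.exp_le_one_iff.2 (by nlinarith)
    linarith
  have h1 : eLpNorm (fun ω => ∫ r in s..t, l * Real.exp (-l * (t - r)) * (B r ω - B s ω)) q μ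
      ≤ ENNReal.ofReal (c * (t - s) ^ H) := by
    refine (eLpNorm_intervalIntegral_le hst hq hX hXc
      (g := fun r => l * Real.exp (-l * (t - r)) * (c * (t - s) ^ H)) (by fun_prop)
      (fun r _ => by positivity) ?_).trans ?_
    · intro r hr
      refine (eLpNorm_const_smul (l * Real.exp (-l * (t - r))) (fun ω => B r ω - B s ω) q μ).le.trans
        ?_
      rw [Real.enorm_of_nonneg (by positivity)]
      grw [hB s r hs hr.1]
      rw [← ENNReal.ofReal_mul (by positivity)]
      refine ENNReal.ofReal_le_ofReal ?_
      have : (r - s) ^ H ≤ (t - s) ^ H :=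
        Real.rpow_le_rpow (sub_nonneg.2 hr.1) (by linarith [hr.2]) hH0
      grw [this]
    · refine ENNReal.ofReal_le_ofReal ?_
      rw [intervalIntegral.integral_mul_const, integral_mul_exp_neg_mul_sub]
      exact mul_le_of_le_one_left (by positivity) (by linarith [Real.exp_pos (-l * (t - s))])
  have h2 : eLpNorm (fun ω => (1 - Real.exp (-l * (t - s))) * ouPath l (fun r => B r ω) s) q μ
      ≤ ENNReal.ofReal (3 * c * (t - s) ^ H) := by
    refine (eLpNorm_const_smul (1 - Real.exp (-l * (t - s)))
      (fun ω => ouPath l (fun r => B r ω) s) q μ).le.trans ?_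
    rw [Real.enorm_of_nonneg hE]
    grw [eLpNorm_ouPath_le hq hc0 hH0 hH1 hm hc hB0 hB hl hs]
    rw [← ENNReal.ofReal_mul hE]
    refine ENNReal.ofReal_le_ofReal ?_
    have h3 := one_sub_exp_neg_le_rpow (mul_nonneg hl.le hts) hH0 hH1
    rw [Real.mul_rpow hl.le hts, ← neg_mul] at h3
    grw [h3]
    have h4 : l ^ H * l ^ (-H) = 1 := by rw [← Real.rpow_add hl]; simp
    exact le_of_eq (by linear_combination (3 * c * (t - s) ^ H) * h4)
  grw [h1, h2]
  rw [← ENNReal.ofReal_add (by positivity) (by positivity),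
    ← ENNReal.ofReal_add (by positivity) (by positivity)]
  exact ENNReal.ofReal_le_ofReal (le_of_eq (by ring))

/-- The interpolation between the two bounds. -/
theorem eLpNorm_ouPath_sub_le_interpolate (hq : 1 ≤ q) (hc0 : 0 ≤ c) (hH0 : 0 < H) (hH1 : H ≤ 1)
    (hm : ∀ r, AEStronglyMeasurable (B r) μ) (hc : ∀ᵐ ω ∂μ, Continuous fun r => B r ω)
    (hB0 : ∀ t, 0 ≤ t → eLpNorm (B t) q μ ≤ ENNReal.ofReal (c * t ^ H))
    (hB : ∀ s t, 0 ≤ s → s ≤ t →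
      eLpNorm (fun ω => B t ω - B s ω) q μ ≤ ENNReal.ofReal (c * (t - s) ^ H))
    {l s t γ : ℝ} (hl : 0 < l) (hs : 0 ≤ s) (hst : s ≤ t) (hγ0 : 0 ≤ γ) (hγ : γ ≤ H) :
    eLpNorm (fun ω => ouPath l (fun r => B r ω) t - ouPath l (fun r => B r ω) s) q μ ≤
      ENNReal.ofReal (6 * c * (l ^ (-(H - γ)) * (t - s) ^ γ)) := by
  have hts : 0 ≤ t - s := sub_nonneg.2 hst
  -- Below the relaxation time `1/l` the increment bound is the sharper one; beyond it, the uniform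
  -- bound at both times gives `3 + 3 = 6`.
  rcases le_total (l * (t - s)) 1 with h | h
  · refine (eLpNorm_ouPath_sub_le hq hc0 hH0.le hH1 hm hc hB0 hB hl hs hst).trans
      (ENNReal.ofReal_le_ofReal ?_)
    have h1 : (l * (t - s)) ^ (H - γ) ≤ 1 := Real.rpow_le_one (by positivity) h (by linarith)
    rw [Real.mul_rpow hl.le hts] at h1
    have h2 : l ^ (-(H - γ)) * l ^ (H - γ) = 1 := by rw [← Real.rpow_add hl]; simp
    have h3 : (t - s) ^ H = (t - s) ^ (H - γ) * (t - s) ^ γ := by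
      rw [← Real.rpow_add_of_nonneg hts (by linarith) hγ0]; simp
    have h4 : (t - s) ^ (H - γ) ≤ l ^ (-(H - γ)) := by
      calc (t - s) ^ (H - γ) = l ^ (-(H - γ)) * (l ^ (H - γ) * (t - s) ^ (H - γ)) := by
            rw [← mul_assoc, h2, one_mul]
        _ ≤ l ^ (-(H - γ)) * 1 := by gcongr
        _ = _ := mul_one _
    rw [h3]
    grw [h4]
    gcongr
    norm_num
  · have ht : 0 ≤ t := hs.trans hst
    refine (eLpNorm_sub_le (aestronglyMeasurable_ouPath hm hc l ht)
      (aestronglyMeasurable_ouPath hm hc l hs) hq).trans ?_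
    grw [eLpNorm_ouPath_le hq hc0 hH0.le hH1 hm hc hB0 hB hl hs,
      eLpNorm_ouPath_le hq hc0 hH0.le hH1 hm hc hB0 hB hl ht]
    rw [← ENNReal.ofReal_add (by positivity) (by positivity)]
    refine ENNReal.ofReal_le_ofReal ?_
    have h1 : 1 ≤ (l * (t - s)) ^ γ := Real.one_le_rpow h hγ0
    rw [Real.mul_rpow hl.le hts] at h1
    have h2 : l ^ (-(H - γ)) = l ^ (-H) * l ^ γ := by rw [← Real.rpow_add hl]; ring_nf
    have : l ^ (-H) * 1 ≤ l ^ (-H) * (l ^ γ * (t - s) ^ γ) := by gcongr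
    rw [h2]
    nlinarith

end OUBounds

/-! ### Gaussian moments and fractional Brownian motion -/

/-- The `L^q` norm of a standard Gaussian variable. -/
noncomputable def gaussianLpConst (q : ℝ≥0∞) : ℝ := (eLpNorm id q (gaussianReal 0 1)).toReal

/-- `X` has the law of `σ` times a standard normal variable, so every moment bound reduces to a
variance. -/
theorem eLpNorm_of_hasGaussianLaw {Ω : Type*} [MeasurableSpace Ω] {μ : Measure Ω} {X : Ω → ℝ}
    (hX : HasGaussianLaw X μ) (hmean : ∫ ω, X ω ∂μ = 0) {σ : ℝ} (hσ : 0 ≤ σ)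
    (hvar : ∫ ω, X ω ^ 2 ∂μ = σ ^ 2) {q : ℝ≥0∞} (hq : q ≠ ∞) :
    eLpNorm X q μ = ENNReal.ofReal (gaussianLpConst q * σ) := by
  have hXm := hX.aemeasurable
  have hv : Var[X; μ] = σ ^ 2 := by
    rw [variance_of_integral_eq_zero hXm hmean, hvar]
  have hmap : μ.map X = (gaussianReal 0 1).map (σ * ·) := by
    rw [hX.map_eq_gaussianReal, hmean, hv, gaussianReal_map_const_mul, mul_zero, mul_one]
    congr 1
    ext
    simp [sq_nonneg]
  have h1 : eLpNorm X q μ = eLpNorm id q (μ.map X) := by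
    rw [eLpNorm_map_measure aestronglyMeasurable_id hXm]
    rfl
  rw [h1, hmap, eLpNorm_map_measure aestronglyMeasurable_id (by fun_prop)]
  refine (eLpNorm_const_smul σ (id : ℝ → ℝ) q (gaussianReal 0 1)).trans ?_
  rw [gaussianLpConst, mul_comm, Real.enorm_of_nonneg hσ, ENNReal.ofReal_mul ENNReal.toReal_nonneg,
    ENNReal.ofReal_toReal (memLp_id_gaussianReal' q hq).2.ne]

namespace IsFractionalBrownianMotion

variable {Ω : Type*} [MeasurableSpace Ω] {μ : Measure Ω} {H : ℝ} {β : ℝ≥0 → Ω → ℝ}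

theorem integral_sub_sq (h : IsFractionalBrownianMotion H β μ) (hH : 0 < H) (t s : ℝ≥0) :
    ∫ ω, (β t ω - β s ω) ^ 2 ∂μ = (|(t : ℝ) - s| ^ H) ^ 2 := by
  have hL : ∀ r, MemLp (β r) 2 μ := fun r => (h.gaussian.hasGaussianLaw_eval r).memLp_two
  have hi : ∀ r r', Integrable (fun ω => β r ω * β r' ω) μ := fun r r' => (hL r).integrable_mul (hL r')
  have e : ∀ ω, (β t ω - β s ω) ^ 2 = β t ω * β t ω - 2 * (β t ω * β s ω) + β s ω * β s ω :=
    fun ω => by ring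
  simp_rw [e]
  have hd : Integrable (fun ω => β t ω * β t ω - 2 * (β t ω * β s ω)) μ :=
    (hi t t).sub ((hi t s).const_mul 2)
  rw [integral_add hd (hi s s),
    integral_sub (hi t t) ((hi t s).const_mul 2), integral_const_mul, h.covariance, h.covariance,
    h.covariance, sub_self, sub_self, abs_zero, Real.zero_rpow (by positivity),
    ← Real.rpow_natCast, ← Real.rpow_mul (abs_nonneg _)]
  push_cast
  rw [mul_comm H 2]
  ring

theorem eLpNorm_sub (h : IsFractionalBrownianMotion H β μ) (hH : 0 < H) {q : ℝ≥0∞} (hq : q ≠ ∞)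
    (t s : ℝ≥0) :
    eLpNorm (fun ω => β t ω - β s ω) q μ =
      ENNReal.ofReal (gaussianLpConst q * |(t : ℝ) - s| ^ H) := by
  refine eLpNorm_of_hasGaussianLaw h.gaussian.hasGaussianLaw_fun_sub ?_ (by positivity)
    (h.integral_sub_sq hH t s) hq
  rw [integral_sub (h.gaussian.hasGaussianLaw_eval t).integrable
    (h.gaussian.hasGaussianLaw_eval s).integrable, h.mean, h.mean, sub_zero]

theorem eLpNorm_eq (h : IsFractionalBrownianMotion H β μ) (hH : 0 < H) {q : ℝ≥0∞} (hq : q ≠ ∞)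
    (t : ℝ≥0) :
    eLpNorm (β t) q μ = ENNReal.ofReal (gaussianLpConst q * (t : ℝ) ^ H) := by
  refine eLpNorm_of_hasGaussianLaw (h.gaussian.hasGaussianLaw_eval t) (h.mean t) (by positivity)
    ?_ hq
  simp_rw [pow_two]
  rw [h.covariance, sub_self, abs_zero, Real.zero_rpow (by positivity), ← pow_two,
    ← Real.rpow_natCast, ← Real.rpow_mul t.coe_nonneg]
  push_cast
  rw [mul_comm H 2]
  ring

theorem aestronglyMeasurable (h : IsFractionalBrownianMotion H β μ) (t : ℝ≥0) :
    AEStronglyMeasurable (β t) μ :=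
  (h.gaussian.aemeasurable t).aestronglyMeasurable

theorem ae_continuous_toNNReal (h : IsFractionalBrownianMotion H β μ) :
    ∀ᵐ ω ∂μ, Continuous fun r : ℝ => β r.toNNReal ω :=
  h.cont.mono fun _ hω => hω.comp continuous_real_toNNReal

theorem aestronglyMeasurable_ouPath (h : IsFractionalBrownianMotion H β μ) (l : ℝ) (t : ℝ≥0) :
    AEStronglyMeasurable (fun ω => ouPath l (fun r => β r.toNNReal ω) t) μ :=
  _root_.aestronglyMeasurable_ouPath (fun _ => h.aestronglyMeasurable _) h.ae_continuous_toNNReal l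
    t.2

theorem eLpNorm_toNNReal_le (h : IsFractionalBrownianMotion H β μ) (hH : 0 < H) {q : ℝ≥0∞}
    (hq : q ≠ ∞) (t : ℝ) (ht : 0 ≤ t) :
    eLpNorm (β t.toNNReal) q μ ≤ ENNReal.ofReal (gaussianLpConst q * t ^ H) := by
  rw [h.eLpNorm_eq hH hq, Real.coe_toNNReal t ht]

theorem eLpNorm_toNNReal_sub_le (h : IsFractionalBrownianMotion H β μ) (hH : 0 < H) {q : ℝ≥0∞}
    (hq : q ≠ ∞) (s t : ℝ) (hs : 0 ≤ s) (hst : s ≤ t) :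
    eLpNorm (fun ω => β t.toNNReal ω - β s.toNNReal ω) q μ ≤
      ENNReal.ofReal (gaussianLpConst q * (t - s) ^ H) := by
  rw [h.eLpNorm_sub hH hq, Real.coe_toNNReal t (hs.trans hst), Real.coe_toNNReal s hs,
    abs_of_nonneg (sub_nonneg.2 hst)]

theorem eLpNorm_ouPath_le (h : IsFractionalBrownianMotion H β μ) (hH0 : 0 < H) (hH1 : H ≤ 1)
    {q : ℝ≥0∞} (hq1 : 1 ≤ q) (hq : q ≠ ∞) {l : ℝ} (hl : 0 < l) (t : ℝ≥0) :
    eLpNorm (fun ω => ouPath l (fun r => β r.toNNReal ω) t) q μ ≤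
      ENNReal.ofReal (3 * gaussianLpConst q * l ^ (-H)) :=
  _root_.eLpNorm_ouPath_le hq1 ENNReal.toReal_nonneg hH0.le hH1 (fun _ => h.aestronglyMeasurable _)
    h.ae_continuous_toNNReal (h.eLpNorm_toNNReal_le hH0 hq) (h.eLpNorm_toNNReal_sub_le hH0 hq) hl t.2

theorem eLpNorm_ouPath_sub_le (h : IsFractionalBrownianMotion H β μ) (hH0 : 0 < H) (hH1 : H ≤ 1)
    {q : ℝ≥0∞} (hq1 : 1 ≤ q) (hq : q ≠ ∞) {l γ : ℝ} (hl : 0 < l) (hγ0 : 0 ≤ γ) (hγ : γ ≤ H)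
    {s t : ℝ≥0} (hst : s ≤ t) :
    eLpNorm (fun ω => ouPath l (fun r => β r.toNNReal ω) t -
        ouPath l (fun r => β r.toNNReal ω) s) q μ ≤
      ENNReal.ofReal (6 * gaussianLpConst q * (l ^ (-(H - γ)) * ((t : ℝ) - s) ^ γ)) :=
  eLpNorm_ouPath_sub_le_interpolate hq1 ENNReal.toReal_nonneg hH0 hH1
    (fun _ => h.aestronglyMeasurable _) h.ae_continuous_toNNReal (h.eLpNorm_toNNReal_le hH0 hq)
    (h.eLpNorm_toNNReal_sub_le hH0 hq) hl s.2 (NNReal.coe_le_coe.2 hst) hγ0 hγ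

end IsFractionalBrownianMotion

/-! ### The sine basis and the diagonal form of the semigroup -/

theorem integral_cos_int_mul_pi {n : ℤ} (hn : n ≠ 0) :
    ∫ x in (0 : ℝ)..1, Real.cos (n * Real.pi * x) = 0 := by
  have hc : (n : ℝ) * Real.pi ≠ 0 := mul_ne_zero (by exact_mod_cast hn) Real.pi_ne_zero
  rw [intervalIntegral.integral_comp_mul_left _ hc, integral_cos]
  simp [Real.sin_int_mul_pi]

theorem inner_sineBasis (k l : ℕ) :
    inner ℝ (sineBasis k) (sineBasis l) = if k = l then (1 : ℝ) else 0 := by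
  have h1 : inner ℝ (sineBasis k) (sineBasis l) =
      ∫ x in Set.Ioo (0 : ℝ) 1, sineFun k x * sineFun l x := by
    rw [L2.inner_def]
    refine integral_congr_ae ?_
    filter_upwards [(memLp_sineFun k).coeFn_toLp, (memLp_sineFun l).coeFn_toLp] with x hk hl
    simp only [sineBasis, hk, hl]
    exact mul_comm _ _
  -- Product-to-sum formula. The mode numbers are `k + 1` and `l + 1`, so the sum frequency `k + l +
  -- 2` never vanishes.
  have h2 : ∀ x, sineFun k x * sineFun l x =
      Real.cos ((((k : ℤ) - l : ℤ) : ℝ) * Real.pi * x) -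
        Real.cos ((((k : ℤ) + l + 2 : ℤ) : ℝ) * Real.pi * x) := by
    intro x
    have h3 : √2 * √2 = (2 : ℝ) := Real.mul_self_sqrt (by norm_num)
    have ha : (((k : ℤ) - l : ℤ) : ℝ) * Real.pi * x =
      ((k : ℝ) + 1) * Real.pi * x - ((l : ℝ) + 1) * Real.pi * x := by push_cast; ring
    have hb : (((k : ℤ) + l + 2 : ℤ) : ℝ) * Real.pi * x =
      ((k : ℝ) + 1) * Real.pi * x + ((l : ℝ) + 1) * Real.pi * x := by push_cast; ring
    rw [ha, hb, Real.cos_sub, Real.cos_add, sineFun, sineFun]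
    linear_combination Real.sin (((k : ℝ) + 1) * Real.pi * x) *
      Real.sin (((l : ℝ) + 1) * Real.pi * x) * h3
  rw [h1, ← integral_Ioc_eq_integral_Ioo, ← intervalIntegral.integral_of_le zero_le_one]
  simp_rw [h2]
  rw [intervalIntegral.integral_sub (Continuous.intervalIntegrable (by fun_prop) _ _)
    (Continuous.intervalIntegrable (by fun_prop) _ _),
    integral_cos_int_mul_pi (n := (k : ℤ) + l + 2) (by positivity), sub_zero]
  split_ifs with hkl
  · subst hkl
    simp
  · exact integral_cos_int_mul_pi (by omega)

theorem orthonormal_sineBasis : Orthonormal ℝ sineBasis :=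
  orthonormal_iff_ite.2 inner_sineBasis

theorem dirichletEigenvalue_pos (k : ℕ) : 0 < dirichletEigenvalue k := by
  unfold dirichletEigenvalue
  positivity

theorem heatSemigroup_sineBasis (u : ℝ) (l : ℕ) :
    heatSemigroup u (sineBasis l) = Real.exp (-dirichletEigenvalue l * u) • sineBasis l := by
  rw [heatSemigroup, tsum_eq_single l]
  · rw [inner_sineBasis, if_pos rfl, mul_one]
  · intro k hk
    rw [inner_sineBasis, if_neg hk.symm, mul_zero, zero_smul]

theorem inner_heatSemigroup_sineBasis (u : ℝ) (k l : ℕ) :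
    inner ℝ (heatSemigroup u (sineBasis l)) (sineBasis k) =
      if l = k then Real.exp (-dirichletEigenvalue l * u) else 0 := by
  rw [heatSemigroup_sineBasis, real_inner_smul_left, inner_sineBasis]
  simp

section StochIntegral

variable {Ω : Type*}

theorem stochIntegralC1_zero [MeasurableSpace Ω] (β : ℝ≥0 → Ω → ℝ) (T : ℝ≥0) (ω : Ω) :
    stochIntegralC1 β T (fun _ => 0) ω = 0 := by
  simp [stochIntegralC1]

theorem stochIntegralC1_exp [MeasurableSpace Ω] (β : ℝ≥0 → Ω → ℝ) (T : ℝ≥0) (l : ℝ) (ω : Ω) :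
    stochIntegralC1 β T (fun s => Real.exp (-l * ((T : ℝ) - s))) ω =
      ouPath l (fun r => β r.toNNReal ω) T := by
  rw [stochIntegralC1, ouPath, sub_self, mul_zero, Real.exp_zero, one_mul, Real.toNNReal_coe]
  congr 1
  -- At `T = 0` the interval is a point and `derivWithin` carries no information, but the integral
  -- vanishes.
  rcases eq_or_ne T 0 with rfl | hT
  · simp
  have hT : (0 : ℝ) < T := NNReal.coe_pos.2 (pos_iff_ne_zero.2 hT)
  refine intervalIntegral.integral_congr fun s hs => ?_
  rw [Set.uIcc_of_le hT.le] at hs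
  have hd : HasDerivAt (fun s => Real.exp (-l * ((T : ℝ) - s)))
      (l * Real.exp (-l * ((T : ℝ) - s))) s := by
    simpa [mul_comm] using
      (((hasDerivAt_id s).const_sub (T : ℝ)).const_mul (-l)).exp
  simp only [hd.hasDerivWithinAt.derivWithin (uniqueDiffOn_Icc hT s hs)]

theorem stochIntegralC1_heatSemigroup [MeasurableSpace Ω] (β : ℝ≥0 → Ω → ℝ) (T : ℝ≥0) (k l : ℕ) (ω : Ω) :
    stochIntegralC1 β T
      (fun s => inner ℝ (heatSemigroup ((T : ℝ) - s) (sineBasis l)) (sineBasis k)) ω =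
      if l = k then ouPath (dirichletEigenvalue l) (fun r => β r.toNNReal ω) T else 0 := by
  simp_rw [inner_heatSemigroup_sineBasis]
  split_ifs
  · exact stochIntegralC1_exp β T _ ω
  · exact stochIntegralC1_zero β T ω

end StochIntegral

theorem contDiffOn_inner_heatSemigroup (T : ℝ) (k l : ℕ) (S : Set ℝ) :
    ContDiffOn ℝ 1
      (fun s => inner ℝ (heatSemigroup (T - s) (sineBasis l)) (sineBasis k)) S := by
  simp_rw [inner_heatSemigroup_sineBasis]
  split_ifs
  · exact ContDiff.contDiffOn (by fun_prop)
  · exact contDiffOn_const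

/-- The terms are of order `k^(-4γ)`; this is the source of the threshold `1/4`. -/
theorem summable_dirichletEigenvalue_rpow {γ : ℝ} (hγ : 1 / 4 < γ) :
    Summable fun k => (dirichletEigenvalue k ^ (-γ)) ^ 2 := by
  have h : ∀ k, (dirichletEigenvalue k ^ (-γ)) ^ 2 =
      (Real.pi ^ 2) ^ (-2 * γ) * ((k + 1 : ℕ) : ℝ) ^ (-4 * γ) := by
    intro k
    rw [dirichletEigenvalue, ← Real.rpow_natCast, ← Real.rpow_mul (by positivity),
      Real.mul_rpow (by positivity) (by positivity), ← Real.rpow_natCast ((k : ℝ) + 1),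
      ← Real.rpow_mul (by positivity)]
    push_cast
    ring_nf
  simp_rw [h]
  exact (((summable_nat_add_iff 1).2 (Real.summable_nat_rpow.2 (by linarith))).mul_left _)

/-- Squares exhaust the index set, so the unconditional limit can be read along a sequence. -/
theorem tendsto_range_product_range :
    Tendsto (fun n : ℕ => Finset.range n ×ˢ Finset.range n) atTop atTop := by
  refine tendsto_atTop_finset_of_monotone (fun m n h => ?_) fun q => ?_
  · exact Finset.product_subset_product (Finset.range_mono h) (Finset.range_mono h)
  · exact ⟨max q.1 q.2 + 1, by simp⟩

/-! ### Random orthonormal series in a Hilbert space -/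

section HilbertSeries

variable {Ω : Type*} [MeasurableSpace Ω] {μ : Measure Ω} {ι E : Type*}
  [NormedAddCommGroup E] [InnerProductSpace ℝ E] {e : ι → E}

theorem Orthonormal.norm_sum_smul_sq (he : Orthonormal ℝ e) (F : Finset ι) (x : ι → ℝ) :
    ‖∑ i ∈ F, x i • e i‖ ^ 2 = ∑ i ∈ F, x i ^ 2 := by
  rw [← real_inner_self_eq_norm_sq, he.inner_sum]
  simp [pow_two]

theorem aestronglyMeasurable_sum_smul {D : ι → Ω → ℝ} (hD : ∀ i, AEStronglyMeasurable (D i) μ)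
    (F : Finset ι) : AEStronglyMeasurable (fun ω => ∑ i ∈ F, D i ω • e i) μ :=
  Finset.aestronglyMeasurable_fun_sum _ fun i _ => (hD i).smul_const (e i)

theorem eLpNorm_sq_eq {G : Type*} [NormedAddCommGroup G] (f : Ω → G) (r : ℝ≥0∞) :
    eLpNorm (fun ω => ‖f ω‖ ^ 2) r μ = eLpNorm f (2 * r) μ ^ 2 := by
  have := eLpNorm_norm_rpow (μ := μ) (p := r) f (q := 2) (by norm_num)
  rw [mul_comm 2 r]
  simpa using this

/-- By Parseval the squared norm is a sum of squares, to which Minkowski applies in `L^r`; hence the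
exponent `2 * r`. -/
theorem eLpNorm_sum_smul_le (he : Orthonormal ℝ e) {D : ι → Ω → ℝ}
    (hD : ∀ i, AEStronglyMeasurable (D i) μ) {d : ι → ℝ} (hd : ∀ i, 0 ≤ d i) {r : ℝ≥0∞}
    (hr : 1 ≤ r) (hDd : ∀ i, eLpNorm (D i) (2 * r) μ ≤ ENNReal.ofReal (d i)) (F : Finset ι) :
    eLpNorm (fun ω => ∑ i ∈ F, D i ω • e i) (2 * r) μ ≤
      ENNReal.ofReal (√(∑ i ∈ F, d i ^ 2)) := by
  rw [← ENNReal.pow_le_pow_left_iff two_ne_zero, ← eLpNorm_sq_eq]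
  simp_rw [he.norm_sum_smul_sq]
  have h1 : eLpNorm (fun ω => ∑ i ∈ F, D i ω ^ 2) r μ ≤
      ∑ i ∈ F, eLpNorm (fun ω => D i ω ^ 2) r μ := by
    have := eLpNorm_sum_le (μ := μ) (s := F) (f := fun i ω => D i ω ^ 2)
      (fun i _ => (hD i).pow 2) hr
    convert this using 2
    ext ω
    simp
  refine h1.trans ?_
  rw [← ENNReal.ofReal_pow (Real.sqrt_nonneg _), Real.sq_sqrt (by positivity),
    ENNReal.ofReal_sum_of_nonneg fun i _ => by positivity]
  refine Finset.sum_le_sum fun i _ => ?_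
  have h2 := eLpNorm_sq_eq (μ := μ) (D i) r
  simp only [Real.norm_eq_abs, sq_abs] at h2
  rw [h2, ENNReal.ofReal_pow (hd i)]
  gcongr
  exact hDd i

theorem memLp_smul_const_of_eLpNorm_le {D : Ω → ℝ} (hD : AEStronglyMeasurable D μ) {r : ℝ≥0∞}
    {d : ℝ} (hDd : eLpNorm D r μ ≤ ENNReal.ofReal d) (x : E) :
    MemLp (fun ω => D ω • x) r μ :=
  (ContinuousLinearMap.toSpanSingleton ℝ x).comp_memLp' ⟨hD, hDd.trans_lt ENNReal.ofReal_lt_top⟩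

/-- Cauchy criterion in `L²(Ω; E)`: the norm of any finite block is controlled by the same block of
`∑ d i ^ 2`. Arbitrary finite blocks are allowed, so convergence is unconditional. -/
theorem exists_tendsto_eLpNorm_sum_smul [CompleteSpace E] (he : Orthonormal ℝ e) {D : ι → Ω → ℝ}
    (hD : ∀ i, AEStronglyMeasurable (D i) μ) {d : ι → ℝ} (hd : ∀ i, 0 ≤ d i)
    (hDd : ∀ i, eLpNorm (D i) 2 μ ≤ ENNReal.ofReal (d i)) (hsum : Summable fun i => d i ^ 2) :
    ∃ X : Ω → E, AEStronglyMeasurable X μ ∧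
      Tendsto (fun F : Finset ι => eLpNorm (fun ω => X ω - ∑ i ∈ F, D i ω • e i) 2 μ)
        atTop (𝓝 0) := by
  have hmem : ∀ i, MemLp (fun ω => D i ω • e i) 2 μ :=
    fun i => memLp_smul_const_of_eLpNorm_le (hD i) (hDd i) (e i)
  have hcoe : ∀ F : Finset ι, ⇑(∑ i ∈ F, (hmem i).toLp _) =ᵐ[μ] fun ω => ∑ i ∈ F, D i ω • e i := by
    intro F
    refine (Lp.coeFn_finsetSum F _).trans ?_
    have h : ∀ᵐ ω ∂μ, ∀ i ∈ F, (hmem i).toLp (fun ω => D i ω • e i) ω = D i ω • e i :=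
      (ae_ball_iff F.countable_toSet).2 fun i _ => (hmem i).coeFn_toLp
    filter_upwards [h] with ω hω
    rw [Finset.sum_apply]
    exact Finset.sum_congr rfl hω
  have hS : Summable fun i => (hmem i).toLp _ := by
    rw [summable_iff_vanishing_norm]
    intro ε hε
    obtain ⟨s, hs⟩ := summable_iff_vanishing_norm.1 hsum (ε ^ 2) (by positivity)
    refine ⟨s, fun F hF => ?_⟩
    have h1 := hs F hF
    rw [Real.norm_of_nonneg (by positivity)] at h1
    have h2 := eLpNorm_sum_smul_le he hD hd le_rfl (by simpa using hDd) F
    rw [mul_one] at h2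
    rw [Lp.norm_def, eLpNorm_congr_ae (hcoe F)]
    exact (ENNReal.toReal_le_of_le_ofReal (Real.sqrt_nonneg _) h2).trans_lt
      ((Real.sqrt_lt' hε).2 h1)
  obtain ⟨X, hX⟩ := hS
  refine ⟨X, Lp.aestronglyMeasurable X, ?_⟩
  have h := (Lp.tendsto_Lp_iff_tendsto_eLpNorm' _ _).1 hX
  refine h.congr fun F => ?_
  rw [eLpNorm_sub_comm]
  refine eLpNorm_congr_ae ?_
  filter_upwards [hcoe F] with ω hω
  rw [Pi.sub_apply, hω]

end HilbertSeries

/-- A subsequence converges almost surely, and Fatou then applies in any exponent `r`. Thus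
mean-square convergence suffices to transfer bounds on higher moments. -/
theorem eLpNorm_le_of_tendsto_eLpNorm {Ω E : Type*} [MeasurableSpace Ω]
    {μ : Measure Ω} [NormedAddCommGroup E] {f : ℕ → Ω → E} {X : Ω → E}
    (hf : ∀ n, AEStronglyMeasurable (f n) μ) (hX : AEStronglyMeasurable X μ)
    {q r : ℝ≥0∞} (hq : q ≠ 0)
    (h : Tendsto (fun n => eLpNorm (fun ω => X ω - f n ω) q μ) atTop (𝓝 0))
    {C : ℝ≥0∞} (hC : ∀ n, eLpNorm (f n) r μ ≤ C) : eLpNorm X r μ ≤ C := by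
  have h' : Tendsto (fun n => eLpNorm (f n - X) q μ) atTop (𝓝 0) :=
    h.congr fun n => eLpNorm_sub_comm X (f n) q μ
  obtain ⟨ns, -, hns⟩ := (tendstoInMeasure_of_tendsto_eLpNorm hq hf hX h').exists_seq_tendsto_ae
  refine (Lp.eLpNorm_lim_le_liminf_eLpNorm (fun n => hf (ns n)) X hns).trans ?_
  exact liminf_le_of_frequently_le' (Frequently.of_forall fun n => hC (ns n))

theorem integral_norm_pow_le_of_eLpNorm_le {Ω E : Type*} [MeasurableSpace Ω] {μ : Measure Ω}
    [NormedAddCommGroup E] {f : Ω → E} (hf : AEStronglyMeasurable f μ) {n : ℕ} (hn : n ≠ 0) {A : ℝ}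
    (hA : 0 ≤ A) (h : eLpNorm f n μ ≤ ENNReal.ofReal A) : ∫ ω, ‖f ω‖ ^ n ∂μ ≤ A ^ n := by
  have hm : MemLp f n μ := ⟨hf, h.trans_lt ENNReal.ofReal_lt_top⟩
  rw [hm.eLpNorm_eq_integral_rpow_norm (by exact_mod_cast hn) (ENNReal.natCast_ne_top n),
    ENNReal.ofReal_le_ofReal_iff hA] at h
  simp only [ENNReal.toReal_natCast, Real.rpow_natCast] at h
  have h2 := pow_le_pow_left₀ (by positivity) h n
  rwa [Real.rpow_inv_natCast_pow (by positivity) hn] at h2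

/-! ### The fractional Ornstein–Uhlenbeck process -/

section FractionalOU

variable {Ω : Type*} [MeasurableSpace Ω] {μ : Measure Ω} {β : ℕ → ℝ≥0 → Ω → ℝ} {H : ℝ}

/-- Off-diagonal coefficients vanish, so only the diagonal part of `F` survives. -/
theorem sum_stochIntegralC1_heatSemigroup_product (β : ℕ → ℝ≥0 → Ω → ℝ) (T : ℝ≥0)
    (F : Finset (ℕ × ℕ)) (ω : Ω) :
    ∑ q ∈ F, stochIntegralC1 (β q.2) T
        (fun s => inner ℝ (heatSemigroup ((T : ℝ) - s) (sineBasis q.2)) (sineBasis q.1)) ω •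
          sineBasis q.1 =
      ∑ k ∈ F.preimage (fun k => (k, k)) (Function.Injective.injOn fun _ _ h => congrArg Prod.fst h),
        ouPath (dirichletEigenvalue k) (fun r => β k r.toNNReal ω) T • sineBasis k := by
  simp_rw [stochIntegralC1_heatSemigroup]
  rw [← Finset.sum_preimage (fun k : ℕ => (k, k)) F
    (Function.Injective.injOn fun _ _ h => congrArg Prod.fst h)]
  · simp
  · rintro ⟨k, l⟩ _ h
    have : l ≠ k := fun hlk => h ⟨k, by rw [hlk]⟩
    simp [this]

theorem IsFractionalOU.aestronglyMeasurable {Z : ℝ≥0 → Ω → L2Unit} (hZ : IsFractionalOU μ β Z)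
    (t : ℝ≥0) : AEStronglyMeasurable (Z t) μ :=
  (hZ t).aestronglyMeasurable

theorem IsFractionalOU.tendsto_range {Z : ℝ≥0 → Ω → L2Unit} (hZ : IsFractionalOU μ β Z)
    (t : ℝ≥0) :
    Tendsto (fun n : ℕ => eLpNorm (fun ω => Z t ω - ∑ k ∈ Finset.range n,
      ouPath (dirichletEigenvalue k) (fun r => β k r.toNNReal ω) t • sineBasis k) 2 μ)
      atTop (𝓝 0) := by
  refine ((hZ t).tendsto.comp tendsto_range_product_range).congr fun n => ?_
  simp only [Function.comp_apply, sum_stochIntegralC1_heatSemigroup_product]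
  congr! with ω
  ext k
  simp

theorem IsCylindricalFBM.exists_isFractionalOU (h : IsCylindricalFBM H β μ) (hH : 1 / 4 < H)
    (hH1 : H ≤ 1) : ∃ Z : ℝ≥0 → Ω → L2Unit, IsFractionalOU μ β Z := by
  have hH0 : 0 < H := by linarith
  have hex : ∀ t : ℝ≥0, ∃ X : Ω → L2Unit, IsCylindricalIntegral μ β t
      (fun s => heatSemigroup ((t : ℝ) - s)) X := by
    intro t
    obtain ⟨X, hX, hlim⟩ := exists_tendsto_eLpNorm_sum_smul orthonormal_sineBasis
      (fun k => (h.fbm k).aestronglyMeasurable_ouPath (dirichletEigenvalue k) t)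
      (d := fun k => 3 * gaussianLpConst 2 * dirichletEigenvalue k ^ (-H))
      (fun k => mul_nonneg (mul_nonneg (by norm_num) ENNReal.toReal_nonneg)
        (Real.rpow_nonneg (dirichletEigenvalue_pos k).le _))
      (fun k => (h.fbm k).eLpNorm_ouPath_le hH0 hH1 one_le_two ENNReal.ofNat_ne_top
        (dirichletEigenvalue_pos k) t)
      (by
        simp_rw [mul_pow _ (_ ^ (-H))]
        exact (summable_dirichletEigenvalue_rpow hH).mul_left _)
    refine ⟨X, fun k l => contDiffOn_inner_heatSemigroup _ k l _, hX, ?_⟩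
    simp_rw [sum_stochIntegralC1_heatSemigroup_product]
    exact hlim.comp (tendsto_finset_preimage_atTop_atTop fun _ _ h => congrArg Prod.fst h)
  choose Z hZ using hex
  exact ⟨Z, hZ⟩

/-- The interpolated one-mode bounds are square summable when `H - γ > 1/4`; they bound all partial
sums of the increment, hence its limit. -/
theorem IsFractionalOU.eLpNorm_sub_le {Z : ℝ≥0 → Ω → L2Unit} (hZ : IsFractionalOU μ β Z)
    (h : IsCylindricalFBM H β μ) (hH0 : 0 < H) (hH1 : H ≤ 1) {r : ℝ≥0∞} (hr1 : 1 ≤ r) (hr : r ≠ ∞)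
    {γ : ℝ} (hγ0 : 0 ≤ γ) (hγ : 1 / 4 < H - γ) {s t : ℝ≥0} (hst : s ≤ t) :
    eLpNorm (fun ω => Z t ω - Z s ω) (2 * r) μ ≤ ENNReal.ofReal (6 * gaussianLpConst (2 * r) *
      √(∑' k, (dirichletEigenvalue k ^ (-(H - γ))) ^ 2) * ((t : ℝ) - s) ^ γ) := by
  set Y : ℝ≥0 → ℕ → Ω → ℝ := fun t k ω =>
    ouPath (dirichletEigenvalue k) (fun r => β k r.toNNReal ω) t with hY
  have hYm : ∀ t k, AEStronglyMeasurable (Y t k) μ :=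
    fun t k => (h.fbm k).aestronglyMeasurable_ouPath _ t
  have hts : (0 : ℝ) ≤ t - s := sub_nonneg.2 (NNReal.coe_le_coe.2 hst)
  have hκ : 0 ≤ gaussianLpConst (2 * r) := ENNReal.toReal_nonneg
  have hsum := summable_dirichletEigenvalue_rpow hγ
  set S := ∑' k, (dirichletEigenvalue k ^ (-(H - γ))) ^ 2 with hS
  have hlim : Tendsto (fun n : ℕ => eLpNorm (fun ω => (Z t ω - Z s ω) -
      ∑ k ∈ Finset.range n, (Y t k ω - Y s k ω) • sineBasis k) 2 μ) atTop (𝓝 0) := by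
    have h0 := (hZ.tendsto_range t).add (hZ.tendsto_range s)
    rw [add_zero] at h0
    refine tendsto_of_tendsto_of_tendsto_of_le_of_le tendsto_const_nhds h0
      (fun _ => zero_le) fun n => ?_
    have := _root_.MeasureTheory.eLpNorm_sub_le (p := 2)
      ((hZ.aestronglyMeasurable t).sub (aestronglyMeasurable_sum_smul (e := sineBasis) (hYm t)
        (Finset.range n)))
      ((hZ.aestronglyMeasurable s).sub (aestronglyMeasurable_sum_smul (e := sineBasis) (hYm s)
        (Finset.range n))) one_le_two
    refine le_trans (le_of_eq (congrArg (fun f => eLpNorm f 2 μ) ?_)) this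
    ext1 ω
    simp only [Pi.sub_apply, sub_smul, Finset.sum_sub_distrib]
    abel
  refine eLpNorm_le_of_tendsto_eLpNorm (fun n => aestronglyMeasurable_sum_smul
    (fun k => (hYm t k).sub (hYm s k)) _)
    ((hZ.aestronglyMeasurable t).sub (hZ.aestronglyMeasurable s)) two_ne_zero hlim fun n => ?_
  refine (eLpNorm_sum_smul_le orthonormal_sineBasis (D := fun k ω => Y t k ω - Y s k ω)
    (fun k => (hYm t k).sub (hYm s k))
    (d := fun k => 6 * gaussianLpConst (2 * r) *
      (dirichletEigenvalue k ^ (-(H - γ)) * ((t : ℝ) - s) ^ γ))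
    (fun k => by have := (dirichletEigenvalue_pos k).le; positivity) hr1
    (fun k => (h.fbm k).eLpNorm_ouPath_sub_le hH0 hH1 (one_le_mul one_le_two hr1)
      (ENNReal.mul_ne_top ENNReal.ofNat_ne_top hr) (dirichletEigenvalue_pos k) hγ0 (by linarith)
      hst) (Finset.range n)).trans (ENNReal.ofReal_le_ofReal ?_)
  have hle : ∑ k ∈ Finset.range n, (dirichletEigenvalue k ^ (-(H - γ))) ^ 2 ≤ S :=
    hsum.sum_le_tsum _ fun _ _ => sq_nonneg _
  have hS0 : 0 ≤ S := tsum_nonneg fun _ => sq_nonneg _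
  refine Real.sqrt_le_iff.2 ⟨by positivity, ?_⟩
  simp_rw [mul_pow, ← Finset.mul_sum, ← Finset.sum_mul]
  rw [Real.sq_sqrt hS0, mul_assoc _ S]
  gcongr

end FractionalOU

/-! ### The moment estimate -/

theorem mainTheorem5 (p : ℕ) (hp : 1 ≤ p) (H : ℝ)
    (hH : H ∈ Set.Ioo (1 / 4 : ℝ) (1 / 2) ∪ Set.Ioo (1 / 2 : ℝ) 1)
    (α : ℝ) (hα : α ∈ Set.Ioo (0 : ℝ) (2 * H - 1 / 2)) :
    ∃ C : ℝ, 0 < C ∧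
      ∀ (Ω : Type*) [MeasurableSpace Ω] (μ : Measure Ω) [IsProbabilityMeasure μ]
        (β : ℕ → ℝ≥0 → Ω → ℝ), IsCylindricalFBM H β μ →
        (∃ Z : ℝ≥0 → Ω → L2Unit, IsFractionalOU μ β Z) ∧
        ∀ Z : ℝ≥0 → Ω → L2Unit, IsFractionalOU μ β Z →
          ∀ t₁ t₂ : ℝ≥0, t₁ ≤ t₂ →
            MemLp (fun ω => Z t₂ ω - Z t₁ ω) ((2 * p : ℕ) : ℝ≥0∞) μ ∧
            ∫ ω, ‖Z t₂ ω - Z t₁ ω‖ ^ (2 * p) ∂μ ≤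
              C * |(t₂ : ℝ) - (t₁ : ℝ)| ^ ((p : ℝ) * α) := by
  have hH1 : H ≤ 1 := by rcases hH with h | h <;> linarith [h.2]
  have hH0 : 1 / 4 < H := by rcases hH with h | h <;> linarith [h.1]
  have hp1 : (1 : ℝ≥0∞) ≤ p := by exact_mod_cast hp
  have hp0 : 2 * p ≠ 0 := by omega
  set A : ℝ := 6 * gaussianLpConst (2 * p) *
    √(∑' k, (dirichletEigenvalue k ^ (-(H - α / 2))) ^ 2) with hAdef
  have hA : 0 ≤ A := mul_nonneg (mul_nonneg (by norm_num) ENNReal.toReal_nonneg) (Real.sqrt_nonneg _)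
  -- Only `A ≥ 0` has been established; the added 1 makes the constant positive.
  refine ⟨A ^ (2 * p) + 1, by positivity, fun Ω _ μ _ β hβ => ⟨hβ.exists_isFractionalOU hH0 hH1, ?_⟩⟩
  intro Z hZ t₁ t₂ ht
  have hts : (0 : ℝ) ≤ t₂ - t₁ := sub_nonneg.2 (NNReal.coe_le_coe.2 ht)
  have hm : AEStronglyMeasurable (fun ω => Z t₂ ω - Z t₁ ω) μ :=
    (hZ.aestronglyMeasurable t₂).sub (hZ.aestronglyMeasurable t₁)
  have hnorm : eLpNorm (fun ω => Z t₂ ω - Z t₁ ω) ((2 * p : ℕ) : ℝ≥0∞) μ ≤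
      ENNReal.ofReal (A * ((t₂ : ℝ) - t₁) ^ (α / 2)) := by
    -- With `γ = α/2`, the condition `H - γ > 1/4` is exactly `α < 2H - 1/2`, and the power `2p`
    -- turns `γ` into `pα`.
    have := hZ.eLpNorm_sub_le hβ (by linarith) hH1 hp1 (ENNReal.natCast_ne_top p)
      (γ := α / 2) (by linarith [hα.1]) (by linarith [hα.2]) ht
    rwa [← hAdef, show (2 : ℝ≥0∞) * p = (2 * p : ℕ) by push_cast; rfl] at this
  refine ⟨⟨hm, hnorm.trans_lt ENNReal.ofReal_lt_top⟩, ?_⟩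
  refine (integral_norm_pow_le_of_eLpNorm_le hm hp0 (by positivity) hnorm).trans ?_
  have hpow : (((t₂ : ℝ) - t₁) ^ (α / 2)) ^ (2 * p) = |(t₂ : ℝ) - t₁| ^ ((p : ℝ) * α) := by
    rw [abs_of_nonneg hts, ← Real.rpow_natCast, ← Real.rpow_mul hts]
    push_cast
    ring_nf
  rw [mul_pow, hpow]
  gcongr
  linarith
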